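/- Let $G=(V,E)$ be a finite simple undirected graph with $V\neq\emptyset$. For $v\in V$ let $\delta(v)$ be the set of edges incident to $v$, and for a partition $V_1,\dots,V_k$ of $V$ into nonempty sets let $\delta(V_1,\dots,V_k)$ be the set of edges whose endpoints lie in different sets $V_i$. Let $y,z,t\in\mathbb{R}^E$ be a feasible solution of the following mixed integer program for the graphical travelling salesman problem: - $\sum_{e\in F}(1-y_e)+\sum_{e\in\delta(v)\setminus F}y_e\ge 1$ for all $v\in V$ and all $F\subseteq\delta(v)$ with $|F|$ odd; - $\sum_{e\in\delta(V_1,\dots,V_k)}t_e\ge k-1$ for all partitions $V_1,\dots,V_k$ of $V$; - $t_e\le y_e+z_e\le 1$, $0\le t_e\le 1$, $0\le z_e\le 1$ and $y_e\in\{0,1\}$ for all $e\in E$. An *Euler tour* is a closed walk in $G$ that visits every vertex at least once; it is identified with the vector $\chi\in\mathbb{R}^E$ in which $\chi_e$ is the number of times the walk traverses $e$. Then $x:=y+2z$ is a convex combination of (one or more) Euler tours. -/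

import Mathlib

namespace GTSP

variable {V : Type*} [Fintype V] [DecidableEq V]

/-- `δ(v)`: the set of edges of `G` incident to the vertex `v`. -/
def delta (G : SimpleGraph V) [DecidableRel G.Adj] (v : V) : Finset G.edgeSet :=
  Finset.univ.filter fun e => v ∈ (e : Sym2 V)

/-- `δ(V₁, …, V_k)`: the set of edges of `G` whose endpoints lie in different parts of the
partition `P = {V₁, …, V_k}` of the vertex set. -/
def crossing (G : SimpleGraph V) [DecidableRel G.Adj]
    (P : Finpartition (Finset.univ : Finset V)) : Finset G.edgeSet :=
  Finset.univ.filter fun e => ∃ a b : V, (e : Sym2 V) = s(a, b) ∧ P.part a ≠ P.part b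

/-- `(y, z, t)` satisfies all the constraints of the mixed integer program. -/
structure IsFeasible (G : SimpleGraph V) [DecidableRel G.Adj] (y z t : G.edgeSet → ℝ) :
    Prop where
  /-- Even-degree constraints. -/
  even_degree : ∀ (v : V) (F : Finset G.edgeSet), F ⊆ delta G v → Odd F.card →
    1 ≤ ∑ e ∈ F, (1 - y e) + ∑ e ∈ delta G v \ F, y e
  /-- Partition inequalities. -/
  partition : ∀ P : Finpartition (Finset.univ : Finset V),
    (P.parts.card : ℝ) - 1 ≤ ∑ e ∈ crossing G P, t e
  t_le : ∀ e, t e ≤ y e + z e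
  add_le_one : ∀ e, y e + z e ≤ 1
  t_mem : ∀ e, 0 ≤ t e ∧ t e ≤ 1
  z_mem : ∀ e, 0 ≤ z e ∧ z e ≤ 1
  y_binary : ∀ e, y e = 0 ∨ y e = 1

/-- `χ` is the edge vector of an Euler tour (a tour of the graphical travelling salesman problem):
there is a closed walk in `G` that visits every vertex at least once and traverses each edge `e`
exactly `χ e` times. Equivalently, the walk is an Eulerian circuit of the spanning multigraph
consisting of `χ e` copies of each edge `e`. -/
def IsEulerTour (G : SimpleGraph V) (χ : G.edgeSet → ℝ) : Prop :=
  ∃ (v : V) (p : G.Walk v v), (∀ u, u ∈ p.support) ∧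
    ∀ e : G.edgeSet, χ e = (p.edges.count (e : Sym2 V) : ℝ)

end GTSP

namespace GTSP

open SimpleGraph

/-! ### Eulerian circuits in multigraphs. -/

section Euler

/-! Since `y` is the indicator of an even subgraph, doubling any edge set `B` that makes its union
with this subgraph connected and spanning yields an Euler tour `y + 2·1_B`
(`isEulerTour_add_two_mul`). These tours alone suffice. Otherwise a linear functional with
coefficients `d` is strictly smaller at `x` than at all of them. The weights `y + z ≥ t` satisfy the
partition inequalities, so a greedy spanning set costs no more than `y + z` for any nonnegative cost
(`exists_connecting_finset`). With cost 0 where `y = 1` and `max d 0` elsewhere, this set yields a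
`B` whose tour has value at most that of `x`, a contradiction. -/

lemma sum_count_edges_eq_length {V : Type*} [Fintype V] [DecidableEq V] {G : SimpleGraph V}
    [DecidableRel G.Adj] {u v : V} (p : G.Walk u v) :
    ∑ e : G.edgeSet, p.edges.count (e : Sym2 V) = p.length := by
  induction p with
  | nil => simp
  | @cons a b c h p ih =>
    have h1 : ∑ e : G.edgeSet, (if s(a, b) = (e : Sym2 V) then 1 else 0) = 1 := by
      rw [Finset.sum_eq_single ⟨s(a, b), h⟩] <;> grind
    simp only [Walk.edges_cons, List.count_cons, beq_iff_eq, Finset.sum_add_distrib, ih, h1,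
      Walk.length_cons]

/-- The degree of `x` in the multigraph of edges traversed by a walk is even, unless `x` is exactly
one of the two endpoints. -/
lemma even_sum_count_edges {V : Type*} [Fintype V] [DecidableEq V] {G : SimpleGraph V}
    [DecidableRel G.Adj] {u v : V} (p : G.Walk u v) (x : V) :
    Even (∑ e ∈ delta G x, p.edges.count (e : Sym2 V)
      + (if x = u then 1 else 0) + (if x = v then 1 else 0)) := by
  induction p with
  | nil =>
    simp only [Walk.edges_nil, List.count_nil, Finset.sum_const_zero, zero_add, Even.add_self]
  | @cons a b c h p ih =>
    have h1 : ∑ e ∈ delta G x, (if s(a, b) = (e : Sym2 V) then 1 else 0)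
        = (if x = a then 1 else 0) + (if x = b then 1 else 0) := by
      have hab := h.ne
      by_cases hx : x ∈ s(a, b)
      · rw [Finset.sum_eq_single ⟨s(a, b), h⟩]
        · rw [Sym2.mem_iff] at hx
          grind
        · grind
        · simp [delta, hx]
      · rw [Finset.sum_eq_zero]
        · rw [Sym2.mem_iff] at hx
          grind
        · intro e he
          simp only [delta, Finset.mem_filter] at he
          grind
    simp only [Walk.edges_cons, List.count_cons, beq_iff_eq, Finset.sum_add_distrib, h1]
    grind

/-- Euler's theorem for multigraphs: an even connected spanning multigraph has an Eulerian
circuit. -/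
lemma exists_closed_walk_count_edges_eq {V : Type*} [Fintype V] [DecidableEq V] [Nonempty V]
    {G H : SimpleGraph V} [DecidableRel G.Adj] (m : G.edgeSet → ℕ)
    (heven : ∀ v, Even (∑ e ∈ delta G v, m e)) (hconn : H.Preconnected)
    (hH : ∀ a b, H.Adj a b → ∃ h : G.Adj a b, m ⟨s(a, b), h⟩ ≠ 0) :
    ∃ (v : V) (p : G.Walk v v), (∀ u, u ∈ p.support) ∧
      ∀ e : G.edgeSet, p.edges.count (e : Sym2 V) = m e := by
  classical
  -- A longest walk within the multiplicities `m` will be the Eulerian circuit.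
  let Q : ℕ → Prop := fun n => ∃ (u v : V) (p : G.Walk u v),
    (∀ e : G.edgeSet, p.edges.count (e : Sym2 V) ≤ m e) ∧ p.length = n
  have hbound : ∀ n, Q n → n ≤ ∑ e, m e := by
    rintro n ⟨u, v, p, hp, rfl⟩
    rw [← sum_count_edges_eq_length]
    exact Finset.sum_le_sum fun e _ => hp e
  obtain ⟨v₀⟩ := ‹Nonempty V›
  have hQ0 : Q 0 := ⟨v₀, v₀, .nil, by simp, rfl⟩
  have hQ := Nat.findGreatest_spec (P := Q) (Nat.zero_le (∑ e, m e)) hQ0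
  set n := Nat.findGreatest Q (∑ e, m e)
  have hmax : ¬ Q (n + 1) := fun h => by
    have := Nat.le_findGreatest (hbound _ h) h
    omega
  obtain ⟨u, v, p, hp, hn⟩ := hQ
  have extend : ∀ {a b c : V} (q : G.Walk a b) (h : G.Adj b c), q.length = n →
      (∀ e : G.edgeSet, q.edges.count (e : Sym2 V) ≤ m e) →
      m ⟨s(b, c), h⟩ ≤ q.edges.count s(b, c) := by
    intro a b c q h hq hle
    by_contra! hlt
    refine hmax ⟨a, c, q.concat h, fun e => ?_, by simp [hq]⟩
    have := hle e
    by_cases he : s(b, c) = (e : Sym2 V)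
    · obtain rfl : ⟨s(b, c), h⟩ = e := Subtype.ext he
      simpa [Walk.edges_concat, List.concat_eq_append] using hlt
    · simpa [Walk.edges_concat, List.concat_eq_append, List.count_singleton, he] using this
  -- On an open walk the used degree at `v` is odd while the `m`-degree is even, so a spare copy of
  -- an edge at `v` would extend the walk.
  obtain rfl : u = v := by
    by_contra huv
    have h1 := even_sum_count_edges p v
    have h2 := heven v
    have h3 : ∃ e ∈ delta G v, p.edges.count (e : Sym2 V) < m e := by
      by_contra! hcon
      rw [Finset.sum_congr rfl fun e he => le_antisymm (hp e) (hcon e he)] at h1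
      simp only [Ne.symm huv, if_false, if_true] at h1
      grind
    obtain ⟨⟨e, he⟩, hev, hlt⟩ := h3
    simp only [delta, Finset.mem_filter, Finset.mem_univ, true_and] at hev
    obtain ⟨b, rfl⟩ := hev
    exact (extend p he hn hp).not_gt hlt
  -- Rotated to end at `a`, the closed walk could be extended by any unused copy at `a`.
  have full : ∀ a b (h : G.Adj a b), a ∈ p.support → m ⟨s(a, b), h⟩ = p.edges.count s(a, b) := by
    intro a b h ha
    have hperm := (p.rotate_edges a ha).perm
    refine le_antisymm ?_ (hp ⟨s(a, b), h⟩)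
    rw [← hperm.count_eq]
    refine extend (p.rotate a ha) h (by simpa using hn) fun e => ?_
    rw [hperm.count_eq]
    exact hp e
  have hsupp : ∀ a, a ∈ p.support := by
    intro a
    obtain ⟨q⟩ := hconn u a
    have : ∀ {b c : V}, H.Walk b c → b ∈ p.support → c ∈ p.support := by
      intro b c q
      induction q with
      | nil => exact id
      | @cons b d c h q ih =>
        intro hb
        obtain ⟨hG, hm⟩ := hH _ _ h
        rw [full b d hG hb] at hm
        exact ih (p.snd_mem_support_of_mem_edges (List.count_pos_iff.1 (Nat.pos_of_ne_zero hm)))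
    exact this q p.start_mem_support
  refine ⟨u, p, hsupp, fun ⟨e, he⟩ => ?_⟩
  induction e with
  | h a b => exact (full a b he (hsupp a)).symm

end Euler

/-! ### Partition inequalities and greedy connection. -/

section Spanning

/-- The edges of `G` joining different connected components of `H`. -/
noncomputable def bridging {V : Type*} [Fintype V] [DecidableEq V] (G : SimpleGraph V)
    [DecidableRel G.Adj] (H : SimpleGraph V) : Finset G.edgeSet :=
  open scoped Classical in
  Finset.univ.filter fun e => ∃ a b : V, (e : Sym2 V) = s(a, b) ∧ ¬ H.Reachable a b

lemma bridging_anti {V : Type*} [Fintype V] [DecidableEq V] (G : SimpleGraph V)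
    [DecidableRel G.Adj] {H H' : SimpleGraph V} (h : H ≤ H') : bridging G H' ⊆ bridging G H := by
  intro e he
  simp only [bridging, Finset.mem_filter, Finset.mem_univ, true_and] at he ⊢
  obtain ⟨a, b, hab, hr⟩ := he
  exact ⟨a, b, hab, fun h' => hr (h'.mono h)⟩

/-- The partition inequality for the connected components of a graph. -/
lemma card_connectedComponent_le_sum_bridging {V : Type*} [Fintype V] [DecidableEq V]
    (G : SimpleGraph V) [DecidableRel G.Adj] {w : G.edgeSet → ℝ}
    (hw : ∀ P : Finpartition (Finset.univ : Finset V),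
      (P.parts.card : ℝ) - 1 ≤ ∑ e ∈ crossing G P, w e) (H : SimpleGraph V) :
    (Nat.card H.ConnectedComponent : ℝ) - 1 ≤ ∑ e ∈ bridging G H, w e := by
  classical
  let P : Finpartition (Finset.univ : Finset V) := Finpartition.ofSetoid H.reachableSetoid
  have hpart : ∀ a b, P.part a = P.part b ↔ H.Reachable a b := by
    intro a b
    rw [← P.mem_part_iff_part_eq_part (Finset.mem_univ _) (Finset.mem_univ _),
      Finpartition.mem_part_ofSetoid_iff_rel]
    exact reachable_comm
  have hcross : crossing G P = bridging G H := by
    simp only [crossing, bridging, ne_eq, hpart]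
  have hcard : Nat.card H.ConnectedComponent ≤ P.parts.card := by
    rw [← Nat.card_eq_finsetCard]
    refine Nat.card_le_card_of_injective
      (fun C => (⟨P.part C.out, P.part_mem.2 (Finset.mem_univ _)⟩ : P.parts)) fun C D hCD => ?_
    rw [← Quot.out_eq C, ← Quot.out_eq D]
    exact ConnectedComponent.sound ((hpart _ _).1 (congrArg Subtype.val hCD))
  rw [← hcross]
  refine le_trans ?_ (hw P)
  gcongr

/-- The greedy algorithm: under the partition inequalities, every graph `H` extends to a connected
graph by edges of cost at most that of the fractional solution `w`. -/
lemma exists_connecting_finset {V : Type*} [Fintype V] [DecidableEq V]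
    (G : SimpleGraph V) [DecidableRel G.Adj] {w : G.edgeSet → ℝ} (hw0 : ∀ e, 0 ≤ w e)
    (hw : ∀ P : Finpartition (Finset.univ : Finset V),
      (P.parts.card : ℝ) - 1 ≤ ∑ e ∈ crossing G P, w e)
    (H : SimpleGraph V) (c : G.edgeSet → ℝ) (hc : ∀ e ∈ bridging G H, 0 ≤ c e) :
    ∃ S ⊆ bridging G H, (H ⊔ fromEdgeSet ((↑) '' (S : Set G.edgeSet))).Preconnected ∧
      S.card ≤ Nat.card H.ConnectedComponent - 1 ∧
      ∑ e ∈ S, c e ≤ ∑ e ∈ bridging G H, c e * w e := by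
  classical
  induction hk : Nat.card H.ConnectedComponent using Nat.strong_induction_on generalizing H c with
  | _ k ih =>
  subst hk
  by_cases hH : H.Preconnected
  · exact ⟨∅, by simp, by simpa using hH, by simp,
      by simpa using Finset.sum_nonneg fun e he => mul_nonneg (hc e he) (hw0 e)⟩
  have hk1 : 1 < Nat.card H.ConnectedComponent := by
    rw [Finite.one_lt_card_iff_nontrivial]
    by_contra hcon
    rw [not_nontrivial_iff_subsingleton] at hcon
    exact hH fun a b => ConnectedComponent.exact (Subsingleton.elim _ _)
  have hpart := card_connectedComponent_le_sum_bridging G hw H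
  have hne : (bridging G H).Nonempty := by
    by_contra hcon
    rw [Finset.not_nonempty_iff_eq_empty] at hcon
    rw [hcon, Finset.sum_empty] at hpart
    have : (1 : ℝ) < Nat.card H.ConnectedComponent := by exact_mod_cast hk1
    linarith
  obtain ⟨e₀, he₀, hmin⟩ := (bridging G H).exists_min_image c hne
  obtain ⟨a, b, hab, hr⟩ : ∃ a b : V, (e₀ : Sym2 V) = s(a, b) ∧ ¬ H.Reachable a b := by
    simpa [bridging] using he₀
  have hne_ab : a ≠ b := fun h => hr (h ▸ Reachable.refl _)
  let H' : SimpleGraph V := H ⊔ fromEdgeSet {(e₀ : Sym2 V)}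
  have hle : H ≤ H' := le_sup_left
  have hadj : H'.Adj a b := by simp [H', hab, hne_ab]
  have hcard : Nat.card H'.ConnectedComponent < Nat.card H.ConnectedComponent := by
    have hsurj : Function.Surjective (ConnectedComponent.map (Hom.ofLE hle)) := by
      intro C
      induction C using ConnectedComponent.ind with
      | h v => exact ⟨H.connectedComponentMk v, rfl⟩
    refine lt_of_le_of_ne (Nat.card_le_card_of_surjective _ hsurj) fun heq => hr ?_
    have hbij := hsurj.bijective_of_nat_card_le heq.ge
    exact ConnectedComponent.exact (hbij.1 (ConnectedComponent.sound hadj.reachable))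
  have hanti := bridging_anti G hle
  -- Subtracting the cheapest cost `c e₀` keeps costs nonnegative on the remaining bridging edges.
  -- The amount removed is recovered from the partition inequality for the components of `H`, as
  -- `insert e₀ S` has at most one edge fewer than there are components.
  obtain ⟨S, hS, hSc, hScard, hScost⟩ := ih _ hcard H' (fun e => c e - c e₀)
    (fun e he => sub_nonneg.2 (hmin e (hanti he))) rfl
  have he₀S : e₀ ∉ S := by
    intro h
    have h1 := hS h
    simp only [bridging, Finset.mem_filter, Finset.mem_univ, true_and] at h1
    obtain ⟨a', b', hab', hr'⟩ := h1
    refine hr' (Adj.reachable ?_)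
    rw [← mem_edgeSet, ← hab', hab]
    exact hadj
  have hScard' : S.card + 1 ≤ Nat.card H.ConnectedComponent - 1 := by omega
  refine ⟨insert e₀ S, ?_, ?_, ?_, ?_⟩
  · exact Finset.insert_subset he₀ (hS.trans hanti)
  · refine hSc.mono ?_
    refine sup_le (sup_le le_sup_left (le_sup_of_le_right ?_)) (le_sup_of_le_right ?_)
    · exact fromEdgeSet_mono (by simp)
    · exact fromEdgeSet_mono (by simp [Set.image_insert_eq])
  · rwa [Finset.card_insert_of_notMem he₀S]
  · have h1 : ∑ e ∈ S, c e = ∑ e ∈ S, (c e - c e₀) + S.card * c e₀ := by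
      simp [Finset.sum_sub_distrib]
    have h2 : ∑ e ∈ bridging G H', (c e - c e₀) * w e ≤ ∑ e ∈ bridging G H, (c e - c e₀) * w e :=
      Finset.sum_le_sum_of_subset_of_nonneg hanti fun e he _ =>
        mul_nonneg (sub_nonneg.2 (hmin e he)) (hw0 e)
    have h3 : ∑ e ∈ bridging G H, (c e - c e₀) * w e
        = ∑ e ∈ bridging G H, c e * w e - c e₀ * ∑ e ∈ bridging G H, w e := by
      simp [sub_mul, Finset.sum_sub_distrib, Finset.mul_sum]
    have h4 : (S.card : ℝ) + 1 ≤ Nat.card H.ConnectedComponent - 1 := by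
      have : S.card + 2 ≤ Nat.card H.ConnectedComponent := by omega
      have : (S.card : ℝ) + 2 ≤ Nat.card H.ConnectedComponent := by exact_mod_cast this
      linarith
    have h5 := mul_le_mul_of_nonneg_left (h4.trans hpart) (hc e₀ he₀)
    rw [Finset.sum_insert he₀S]
    linarith

end Spanning

/-! ### From connecting sets to Euler tours and their convex hull. -/

/-- Doubling the edges of `B` makes the even subgraph with indicator `y` an Euler tour, provided
that the union of both is connected and spanning. -/
lemma isEulerTour_add_two_mul {V : Type*} [Fintype V] [DecidableEq V] [Nonempty V]
    {G : SimpleGraph V} [DecidableRel G.Adj] {y z t : G.edgeSet → ℝ} (h : IsFeasible G y z t)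
    (B : Finset G.edgeSet)
    (hB : (fromEdgeSet (Subtype.val '' {e : G.edgeSet | y e = 1 ∨ e ∈ B})).Preconnected) :
    IsEulerTour G fun e => y e + 2 * (if e ∈ B then 1 else 0) := by
  classical
  let m : G.edgeSet → ℕ := fun e => (if y e = 1 then 1 else 0) + 2 * (if e ∈ B then 1 else 0)
  have heven : ∀ v, Even (∑ e ∈ delta G v, m e) := by
    intro v
    rw [Finset.sum_add_distrib, ← Finset.mul_sum, ← Finset.card_filter]
    refine Even.add ?_ (even_two_mul _)
    by_contra hodd
    rw [Nat.not_even_iff_odd] at hodd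
    -- With `F` the edges at `v` where `y = 1`, the left side of the constraint vanishes.
    have hcon := h.even_degree v _ (Finset.filter_subset _ _) hodd
    rw [Finset.sum_eq_zero, Finset.sum_eq_zero] at hcon
    · norm_num at hcon
    · intro e he
      have := h.y_binary e
      grind
    · intro e he
      grind
  obtain ⟨v, p, hp, hcount⟩ := exists_closed_walk_count_edges_eq m heven hB fun a b hab => by
    simp only [fromEdgeSet_adj, Set.mem_image, Set.mem_ofPred_eq] at hab
    obtain ⟨⟨⟨e, he⟩, hyB, rfl⟩, hne⟩ := hab
    refine ⟨he, ?_⟩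
    rcases hyB with h1 | h1 <;> simp [m, h1]
  refine ⟨v, p, hp, fun e => ?_⟩
  rw [hcount]
  rcases h.y_binary e with he | he <;> simp [m, he]

end GTSP

theorem theorem1 {V : Type*} [Fintype V] [DecidableEq V] [Nonempty V]
    (G : SimpleGraph V) [DecidableRel G.Adj] (y z t : G.edgeSet → ℝ)
    (h : GTSP.IsFeasible G y z t) :
    (fun e => y e + 2 * z e) ∈ convexHull ℝ {χ : G.edgeSet → ℝ | GTSP.IsEulerTour G χ} := by
  classical
  let T : Set (G.edgeSet → ℝ) :=
    (fun (B : Finset G.edgeSet) (e : G.edgeSet) => y e + 2 * (if e ∈ B then 1 else 0)) ''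
      {B | (SimpleGraph.fromEdgeSet (Subtype.val '' {e : G.edgeSet | y e = 1 ∨ e ∈ B})).Preconnected}
  have hT : T ⊆ {χ : G.edgeSet → ℝ | GTSP.IsEulerTour G χ} := by
    rintro _ ⟨B, hB, rfl⟩
    exact GTSP.isEulerTour_add_two_mul h B hB
  refine convexHull_mono hT ?_
  by_contra hx
  obtain ⟨f, u, hfx, hfT⟩ := geometric_hahn_banach_point_closed (convex_convexHull ℝ T)
    (((Set.toFinite _).image _).isClosed_convexHull ℝ) hx
  let d : G.edgeSet → ℝ := fun e => f (Pi.single e 1)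
  have hf : ∀ x : G.edgeSet → ℝ, f x = ∑ e, d e * x e := by
    intro x
    conv_lhs => rw [← Finset.univ_sum_single x, map_sum]
    refine Finset.sum_congr rfl fun e _ => ?_
    have : Pi.single e (x e) = x e • (Pi.single e 1 : G.edgeSet → ℝ) := by
      rw [← Pi.single_smul]; simp
    rw [this, map_smul, smul_eq_mul, mul_comm]
  let c : G.edgeSet → ℝ := fun e => if y e = 1 then 0 else max (d e) 0
  have hc : ∀ e, 0 ≤ c e := by
    intro e
    simp only [c]
    split_ifs <;> simp
  obtain ⟨S, -, hSconn, -, hScost⟩ := GTSP.exists_connecting_finset G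
    (w := fun e => y e + z e) (fun e => (h.t_mem e).1.trans (h.t_le e))
    (fun P => (h.partition P).trans (Finset.sum_le_sum fun e _ => h.t_le e)) ⊥ c fun e _ => hc e
  replace hScost : ∑ e ∈ S, c e ≤ ∑ e, c e * (y e + z e) :=
    hScost.trans (Finset.sum_le_sum_of_subset_of_nonneg (Finset.subset_univ _) fun e _ _ =>
      mul_nonneg (hc e) ((h.t_mem e).1.trans (h.t_le e)))
  -- Edges with `y = 1` are already present, and every other edge with `d < 0` is added because it
  -- only lowers the value.
  let B : Finset G.edgeSet := Finset.univ.filter fun e => y e ≠ 1 ∧ (e ∈ S ∨ d e < 0)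
  have hB := hfT _ (subset_convexHull ℝ T ⟨B, ?_, rfl⟩)
  · refine (hfx.trans hB).not_ge ?_
    rw [hf, hf]
    -- Where `y = 1`, `y + z ≤ 1` forces `z = 0`; where `y = 0` and `d < 0`, `z ≤ 1` suffices;
    -- otherwise equality holds. Summed, the correction is nonpositive by `hScost`.
    have key : ∀ e, d e * (y e + 2 * (if e ∈ B then 1 else 0)) ≤
        d e * (y e + 2 * z e) + 2 * ((if e ∈ S then c e else 0) - c e * (y e + z e)) := by
      intro e
      have hz := h.z_mem e
      have hyz := h.add_le_one e
      have hB' : e ∈ B ↔ y e ≠ 1 ∧ (e ∈ S ∨ d e < 0) := by simp [B]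
      rcases h.y_binary e with he | he
      · have hce : c e = max (d e) 0 := by simp [c, he]
        rcases lt_or_ge (d e) 0 with hd | hd
        · have : e ∈ B := hB'.2 ⟨by simp [he], .inr hd⟩
          rw [hce, max_eq_right hd.le, if_pos this, he]
          simp only [ite_self]
          nlinarith
        · rw [hce, max_eq_left hd, he]
          have : e ∈ B ↔ e ∈ S := by
            rw [hB', he]
            simp [hd.not_gt]
          simp only [this]
          split_ifs <;> linarith
      · have hz0 : z e = 0 := by linarith
        have : e ∉ B := by simp [hB', he]
        simp [this, c, he, hz0]
    refine (Finset.sum_le_sum fun e _ => key e).trans ?_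
    rw [Finset.sum_add_distrib, ← Finset.mul_sum, Finset.sum_sub_distrib, Finset.sum_ite_mem,
      Finset.univ_inter]
    linarith
  · refine hSconn.mono (sup_le bot_le (SimpleGraph.fromEdgeSet_mono (Set.image_mono ?_)))
    intro e he
    by_cases hy : y e = 1
    · exact .inl hy
    · exact .inr (by simpa [B, hy] using Or.inl he)
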